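/- Let $\Sigma$ be a set of letters and let $T$ be a finite undirected tree each of whose edges is labelled by a letter of $\Sigma$. A substring of $T$ is a word obtained by reading the edge labels along a simple path of $T$ from one endpoint to the other (a path may consist of a single vertex, in which case the word is empty), and a palindrome is a word equal to its reversal. Let $\mathrm{pals}(T)$ be the set of palindromic substrings of $T$, and let $\mathrm{PAL}_\Sigma(n)$ be the maximum of $|\mathrm{pals}(T)|$ over all trees $T$ with $n$ edges labelled by letters of $\Sigma$. There are absolute constants $c, C > 0$ such that: 1. for every $\Sigma$ and every $n \ge 1$, every tree $T$ with $n$ edges labelled by letters of $\Sigma$ satisfies $|\mathrm{pals}(T)| \le C\, n^{3/2}$; 2. for every $\Sigma$ with at least two letters and every $n \ge 1$, the maximum $\mathrm{PAL}_\Sigma(n)$ exists and $c\, n^{3/2} \le \mathrm{PAL}_\Sigma(n) \le C\, n^{3/2}$. In particular $\mathrm{PAL}_\Sigma(n) = \Theta(n^{3/2})$. -/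

import Mathlib

universe u v

namespace LabelledTree

/-- The label of a walk `p`, read from its start to its end: the concatenation of the letters on
its edges. The labelling is a function on unordered pairs of vertices; only its values on edges of
`G` are ever used. -/
def label {V : Type v} {α : Type u} {G : SimpleGraph V} (lab : Sym2 V → α) {x y : V}
    (p : G.Walk x y) : List α :=
  p.edges.map lab

/-- The substrings of an edge-labelled graph: the labels of its simple paths
(paths of length `0`, whose label is the empty word, included). -/
def substrings {V : Type v} {α : Type u} (G : SimpleGraph V) (lab : Sym2 V → α) :
    Set (List α) :=
  {w | ∃ (x y : V) (p : G.Walk x y), p.IsPath ∧ label lab p = w}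

/-- The palindromic substrings: the substrings that equal their own reversal. -/
def pals {V : Type v} {α : Type u} (G : SimpleGraph V) (lab : Sym2 V → α) : Set (List α) :=
  {w | w ∈ substrings G lab ∧ w = w.reverse}

/-- The possible numbers of distinct palindromic substrings of a tree with `n` edges labelled by
letters of `α`. Up to isomorphism every finite tree has its vertices in `Type`. -/
def palCounts (α : Type u) (n : ℕ) : Set ℕ :=
  {m | ∃ (V : Type) (_ : Finite V) (G : SimpleGraph V) (lab : Sym2 V → α),
    G.IsTree ∧ G.edgeSet.ncard = n ∧ (pals G lab).ncard = m}

/-- The maximal number of distinct palindromic substrings of a tree with `n` edges labelled by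
letters of `α`. -/
noncomputable def PAL (α : Type u) (n : ℕ) : ℕ :=
  sSup (palCounts α n)

end LabelledTree

/-! Upper bound. Cutting at a centroid `r` reduces the problem to palindromes read through `r`
(`card_palsWithin_le`): the pieces have at most half the size, so the `n^{3/2}` bounds sum
geometrically. Such a palindrome is `U.reverse ++ V` with `U`, `V` from a set `L` of at most `n`
words of length at most `n` read from `r`. If `U` is the shorter one, then `V` is a palindrome of
some length `a` followed by `U`, so the pair `(V, a)` determines everything.

Let `p` be the least period of that prefix. If it does not continue for `3 * p` letters beyond `a`,
the possible `a` grow geometrically, leaving `O(log n)` of them per `V` (`growth_of_not_extends`).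
Otherwise both `U` and `V` start with a cube of least period `p` and have the same `endKey`. Fix `p`
and the key, and let `x` be the number of words of `L` starting with such a cube and having this
key. There are at most `x ^ 2` palindromes, one per pair, and at most `3 * n / p`, since the length
is fixed modulo `p` and determines the palindrome. Hence there are at most `x * √(3 * n / p)`.
Summed over keys, each word contributes `√(3 * n) * ∑ 1 / √p` over its cube periods, which more than
double each time, so the sum is `O(√n)` (`card_extends_le`).

Lower bound. A comb with a spine of letters `a` and teeth of letters `b` contains `b^k a^d b^k`
whenever two teeth are at distance `d`. With `2 * m` teeth placed as a difference basis, all `d ≤ m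
^ 2` and `k ≤ m` occur: `m ^ 3` palindromes on `O(m ^ 2)` edges. -/

namespace LabelledTree

/-! ### Periods and palindromic prefixes of a single word -/

section Words

variable {α : Type u}

/-- `p` is a period of the prefix of length `N` of the word `V`. -/
def HasPeriod (V : List α) (p N : ℕ) : Prop := ∀ i, i + p < N → V[i]? = V[i + p]?

/-- The prefix of length `a` of the word `V` is a palindrome. -/
def PalPrefix (V : List α) (a : ℕ) : Prop := a ≤ V.length ∧ ∀ i < a, V[i]? = V[a - 1 - i]?

/-- `p` is the least period of the prefix of length `N` of the word `V`. -/
def IsMinPeriod (V : List α) (p N : ℕ) : Prop :=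
  1 ≤ p ∧ HasPeriod V p N ∧ ∀ d, 1 ≤ d → HasPeriod V d N → p ≤ d

/-- The word obtained from `V` by prepending the reversal of its suffix starting at `a`. -/
def unfold (V : List α) (a : ℕ) : List α := (V.drop a).reverse ++ V

/-- The least period `p` of the prefix of length `a` extends three times beyond `a`. -/
def Extends (V : List α) (a p : ℕ) : Prop :=
  PalPrefix V a ∧ IsMinPeriod V p a ∧ p ≤ a ∧ a + 3 * p ≤ V.length ∧ HasPeriod V p (a + 3 * p)

lemma HasPeriod.mono {V : List α} {p M N : ℕ} (h : HasPeriod V p N) (hMN : M ≤ N) :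
    HasPeriod V p M := fun i hi => h i (by omega)

lemma HasPeriod.eq_mod {V : List α} {p N : ℕ} (h : HasPeriod V p N) (i : ℕ) (hi : i < N) :
    V[i]? = V[i % p]? := by
  induction i using Nat.strong_induction_on with
  | _ i ih =>
    rcases Nat.lt_or_ge i p with hip | hip
    · rw [Nat.mod_eq_of_lt hip]
    · rcases Nat.eq_zero_or_pos p with rfl | hp
      · simp
      · rw [Nat.mod_eq_sub_mod hip, ← ih (i - p) (by omega) (by omega), h (i - p) (by omega)]
        congr 1; omega

lemma HasPeriod.eq_of_mod_eq {V : List α} {p N : ℕ} (h : HasPeriod V p N) {i j : ℕ} (hi : i < N)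
    (hj : j < N) (hij : i % p = j % p) : V[i]? = V[j]? := by
  rw [h.eq_mod i hi, h.eq_mod j hj, hij]

/-- A second relation holding on a full window of length `p` is a period of the whole word. -/
lemma HasPeriod.of_window {V : List α} {p N d m : ℕ} (hp : 1 ≤ p) (h : HasPeriod V p N)
    (hm : m + p + d ≤ N) (hd : ∀ j, m ≤ j → j < m + p → V[j]? = V[j + d]?) :
    HasPeriod V d N := by
  intro i hi
  have hlt := Nat.mod_lt (i + (p - m % p)) hp
  have hmlt := Nat.mod_lt m hp
  set j := m + (i + (p - m % p)) % p with hj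
  have hmod : j % p = i % p := by
    have h1 : j % p = (m + (i + (p - m % p))) % p := by rw [hj, Nat.add_mod_mod]
    rw [h1]
    have h2 : m + (i + (p - m % p)) = i + p * (m / p + 1) := by
      have := Nat.div_add_mod m p
      rw [Nat.mul_add]; omega
    rw [h2, Nat.add_mul_mod_self_left]
  have hmod' : (j + d) % p = (i + d) % p := by
    rw [Nat.add_mod, hmod, ← Nat.add_mod]
  rw [h.eq_of_mod_eq (i := i) (j := j) (by omega) (by omega) hmod.symm, hd j (by omega) (by omega)]
  exact h.eq_of_mod_eq (by omega) (by omega) hmod'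

/-- Two reflections compose to a translation by the difference of the lengths. -/
lemma PalPrefix.hasPeriod {V : List α} {b c : ℕ} (hb : PalPrefix V b) (hc : PalPrefix V c)
    (hbc : b < c) : HasPeriod V (c - b) c := by
  intro i hi
  rw [hb.2 i (by omega), hc.2 (i + (c - b)) hi]
  congr 1; omega

lemma exists_isMinPeriod (V : List α) (a : ℕ) : ∃ p, IsMinPeriod V p a ∧ (1 ≤ a → p ≤ a) := by
  classical
  -- `a + 1` is a vacuous period that is positive even for `a = 0`.
  have hex : ∃ p, 1 ≤ p ∧ HasPeriod V p a := ⟨a + 1, by omega, fun i hi => by omega⟩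
  refine ⟨Nat.find hex, ⟨(Nat.find_spec hex).1, (Nat.find_spec hex).2,
    fun d hd hd' => Nat.find_min' hex ⟨hd, hd'⟩⟩, fun ha => ?_⟩
  exact Nat.find_min' hex ⟨ha, fun i hi => by omega⟩

/-- Palindromic prefixes whose least period does not extend grow geometrically. -/
lemma growth_of_not_extends {V : List α} {a b c e : ℕ} (ha : PalPrefix V a) (hb : PalPrefix V b)
    (hc : PalPrefix V c) (he : PalPrefix V e) (hab : a < b) (hbc : b < c) (hce : c < e)
    (hbad : ∀ p, ¬ Extends V a p) : 7 * a < 4 * e := by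
  by_contra hlt
  obtain ⟨p, ⟨hp1, hpa, hmin⟩, hple⟩ := exists_isMinPeriod V a
  -- Each of the three gaps is a period of the prefix of length `a`, hence at least `p`; so `a + 3 *
  -- p ≤ e`.
  have h1 := hmin (b - a) (by omega) ((ha.hasPeriod hb hab).mono hab.le)
  have h2 := hmin (c - b) (by omega) ((hb.hasPeriod hc hbc).mono (by omega))
  have h3 := hmin (e - c) (by omega) ((hc.hasPeriod he hce).mono (by omega))
  have hd : HasPeriod V (e - a) e := ha.hasPeriod he (by omega)
  have hper : HasPeriod V p e := by
    have key : ∀ t, p ≤ t → t < e → V[t - p]? = V[t]? := by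
      intro t
      induction t using Nat.strong_induction_on with
      | _ t ih =>
        intro htp hte
        rcases Nat.lt_or_ge t a with hta | hta
        · rw [hpa (t - p) (by omega)]; congr 1; omega
        -- The period `e - a` carries `p` from the prefix of length `a` to all of `e`. There is room
        -- for both shifts: `7 * a ≥ 4 * e` gives `e - a ≤ 3 * a / 4`, so `p ≤ a / 4` and `p + (e -
        -- a) ≤ a`.
        · have e1 := ih (t - (e - a)) (by omega) (by omega) (by omega)
          have e2 := hd (t - (e - a)) (by omega)
          have e3 := hd (t - (e - a) - p) (by omega)
          rw [show t - (e - a) + (e - a) = t by omega] at e2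
          rw [show t - (e - a) - p + (e - a) = t - p by omega] at e3
          rw [← e2, ← e3, e1]
    intro i hi
    have := key (i + p) (by omega) hi
    rwa [Nat.add_sub_cancel] at this
  exact hbad p ⟨ha, ⟨hp1, hpa, hmin⟩, hple (by omega), by have := he.1; omega,
    hper.mono (by omega)⟩

/-- Seven elements of one dyadic block would form two quadruples sharing an element, a growth by
more than `(7 / 4) ^ 2 > 2`. The final `+ 1` accounts for `0`. -/
lemma card_le_log_of_growth {X : Finset ℕ} {n : ℕ} (hX : ∀ x ∈ X, x ≤ n)
    (hg : ∀ a ∈ X, ∀ b ∈ X, ∀ c ∈ X, ∀ e ∈ X, a < b → b < c → c < e → 7 * a < 4 * e) :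
    X.card ≤ 6 * (Nat.log 2 n + 1) + 1 := by
  classical
  have h1 : (X.erase 0).card ≤ 6 * ((X.erase 0).image (Nat.log 2)).card := by
    apply Finset.card_le_mul_card_image
    intro k _
    by_contra hcard
    push Not at hcard
    set Y := (X.erase 0).filter (fun x => Nat.log 2 x = k) with hY
    obtain ⟨Z, hZY, hZ⟩ := Finset.exists_subset_card_eq (show 7 ≤ Y.card by omega)
    set f := Z.orderEmbOfFin hZ
    have hmem : ∀ i, f i ∈ X ∧ 2 ^ k ≤ f i ∧ f i < 2 ^ (k + 1) := by
      intro i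
      have := hZY (Z.orderEmbOfFin_mem hZ i)
      simp only [hY, Finset.mem_filter, Finset.mem_erase] at this
      obtain ⟨⟨h0, hx⟩, hl⟩ := this
      refine ⟨hx, ?_, ?_⟩
      · rw [← hl]; exact Nat.pow_log_le_self 2 h0
      · rw [← hl]; exact Nat.lt_pow_succ_log_self (by norm_num) _
    have hlt : ∀ i j : Fin 7, i < j → f i < f j := fun i j h => f.strictMono h
    have g1 := hg _ (hmem 0).1 _ (hmem 1).1 _ (hmem 2).1 _ (hmem 3).1 (hlt _ _ (by decide))
      (hlt _ _ (by decide)) (hlt _ _ (by decide))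
    have g2 := hg _ (hmem 3).1 _ (hmem 4).1 _ (hmem 5).1 _ (hmem 6).1 (hlt _ _ (by decide))
      (hlt _ _ (by decide)) (hlt _ _ (by decide))
    have b0 := (hmem 0).2.1
    have b6 := (hmem 6).2.2
    rw [pow_succ] at b6
    omega
  have h2 : ((X.erase 0).image (Nat.log 2)).card ≤ Nat.log 2 n + 1 := by
    rw [← Finset.card_range (Nat.log 2 n + 1)]
    apply Finset.card_le_card
    intro k hk
    obtain ⟨x, hx, rfl⟩ := Finset.mem_image.1 hk
    have := Nat.log_mono_right (b := 2) (hX x (Finset.mem_of_mem_erase hx))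
    exact Finset.mem_range.2 (by omega)
  have h3 := Finset.pred_card_le_card_erase (s := X) (a := 0)
  omega

lemma log_two_add_one_le_sqrt {n : ℕ} (hn : 1 ≤ n) : (Nat.log 2 n + 1 : ℝ) ≤ 2 * √n := by
  have h1 : ∀ k : ℕ, (k + 1) ^ 2 ≤ 4 * 2 ^ k := by
    intro k
    induction k with
    | zero => norm_num
    | succ k ih =>
      rcases k with _ | _ | k
      · norm_num
      · norm_num
      · rw [pow_succ 2 (k + 1 + 1)]
        have : (k + 1 + 1 + 1 + 1) ^ 2 ≤ 2 * (k + 1 + 1 + 1) ^ 2 := by ring_nf; nlinarith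
        linarith
  have h2 : (Nat.log 2 n + 1) ^ 2 ≤ 4 * n :=
    (h1 _).trans (Nat.mul_le_mul_left 4 (Nat.pow_log_le_self 2 (by omega)))
  have h3 : ((Nat.log 2 n : ℝ) + 1) ^ 2 ≤ 4 * n := by exact_mod_cast h2
  apply le_of_sq_le_sq _ (by positivity)
  rw [mul_pow, Real.sq_sqrt (by positivity)]
  linarith

/-- The least periods of cubic prefixes more than double. -/
lemma two_mul_lt_of_isMinPeriod {V : List α} {p q : ℕ} (hp : IsMinPeriod V p (3 * p))
    (hq : IsMinPeriod V q (3 * q)) (hpq : p < q) : 2 * p < q := by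
  by_contra hle
  obtain ⟨hp1, hpp, hpmin⟩ := hp
  obtain ⟨hq1, hqq, hqmin⟩ := hq
  -- Shift forward by `q` and back by `p`; if that leaves the prefix, shift back first, which is
  -- possible because `q ≤ 2 * p`. Minimality of `p` then leaves only `q = 2 * p`, where `p` itself
  -- is a period of the longer cube.
  have hd : HasPeriod V (q - p) (3 * p) := by
    intro j hj
    rcases Nat.lt_or_ge (j + q) (3 * p) with h | h
    · have e1 := hqq j (by omega)
      have e2 := hpp (j + (q - p)) (by omega)
      rw [show j + (q - p) + p = j + q by omega] at e2
      rw [e1, e2]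
    · have e1 := hpp (j - p) (by omega)
      have e2 := hqq (j - p) (by omega)
      rw [show j - p + p = j by omega] at e1
      rw [show j - p + q = j + (q - p) by omega] at e2
      rw [← e1, e2]
  have h2 := hpmin _ (by omega) hd
  have hq2 : q = 2 * p := by omega
  have := hqmin p hp1 (hqq.of_window (m := 0) hq1 (by omega) fun j _ hj => hpp j (by omega))
  omega

lemma sum_inv_sqrt_le {X : Finset ℕ} (h1 : ∀ x ∈ X, 1 ≤ x)
    (h2 : ∀ x ∈ X, ∀ y ∈ X, x < y → 2 * x < y) : ∑ x ∈ X, (√(x : ℝ))⁻¹ ≤ 4 := by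
  -- The slack `3 / √m`, with `m` the maximum, closes the induction: for the previous maximum `q`,
  -- `m > 2 * q` gives `√m ≥ (4 / 3) * √q`, that is `4 / √m ≤ 3 / √q`.
  suffices H : ∀ X : Finset ℕ, (∀ x ∈ X, 1 ≤ x) → (∀ x ∈ X, ∀ y ∈ X, x < y → 2 * x < y) →
      ∀ m ∈ X, (∀ x ∈ X, x ≤ m) → ∑ x ∈ X, (√(x : ℝ))⁻¹ ≤ 4 - 3 * (√(m : ℝ))⁻¹ by
    rcases X.eq_empty_or_nonempty with rfl | hne
    · simp
    · have := H X h1 h2 _ (X.max'_mem hne) (fun x hx => X.le_max' x hx)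
      have h0 : 0 ≤ (√((X.max' hne : ℕ) : ℝ))⁻¹ := by positivity
      linarith
  intro X
  induction X using Finset.induction_on_max with
  | empty => simp
  | insert a s hmax ih =>
    intro h1 h2 m hm hle
    have hma : m = a := by
      rcases Finset.mem_insert.1 hm with h | h
      · exact h
      · have := hmax m h
        have := hle a (Finset.mem_insert_self _ _)
        omega
    subst hma
    have hnot : m ∉ s := fun h => (hmax m h).false
    rw [Finset.sum_insert hnot]
    have hm1 : (1 : ℝ) ≤ √(m : ℝ) := by
      rw [Real.one_le_sqrt]; exact_mod_cast h1 m (Finset.mem_insert_self _ _)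
    rcases s.eq_empty_or_nonempty with rfl | hne
    · have : (√(m : ℝ))⁻¹ ≤ 1 := inv_le_one_of_one_le₀ hm1
      simp only [Finset.sum_empty]; linarith
    · set q := s.max' hne
      have hq := s.max'_mem hne
      have hs := ih (fun x hx => h1 x (Finset.mem_insert_of_mem hx))
        (fun x hx y hy => h2 x (Finset.mem_insert_of_mem hx) y (Finset.mem_insert_of_mem hy))
        q hq (fun x hx => s.le_max' x hx)
      have hq2 := h2 q (Finset.mem_insert_of_mem hq) m (Finset.mem_insert_self _ _) (hmax q hq)
      have hq1 := h1 q (Finset.mem_insert_of_mem hq)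
      have hq0 : 0 < √(q : ℝ) := Real.sqrt_pos.2 (by exact_mod_cast hq1)
      have hr : (4 / 3) * √(q : ℝ) ≤ √(m : ℝ) := by
        apply Real.le_sqrt_of_sq_le
        rw [mul_pow, Real.sq_sqrt (by positivity)]
        have : (2 * q : ℝ) < m := by exact_mod_cast hq2
        have : (1 : ℝ) ≤ q := by exact_mod_cast hq1
        linarith
      have : 4 * (√(m : ℝ))⁻¹ ≤ 3 * (√(q : ℝ))⁻¹ := by
        rw [← div_eq_mul_inv, ← div_eq_mul_inv, div_le_div_iff₀ (by linarith) hq0]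
        linarith
      linarith

end Words

end LabelledTree

namespace LabelledTree

/-! ### Counting palindromes composed of two words from a given set -/

section Counting

variable {α : Type u}

/-- The two-sided periodic sequence with period `p` that starts like `V`. -/
def periodicExt (V : List α) (p : ℕ) (t : ℤ) : Option α := V[(t % p).toNat]?

/-- The word `V`, read from its end and continued beyond its start with period `p`. -/
def endKey (V : List α) (p : ℕ) (k : ℕ) : Option α :=
  if k < V.length then V[V.length - 1 - k]? else periodicExt V p (V.length - 1 - k)

lemma periodicExt_congr (V : List α) (p : ℕ) {s t : ℤ} (h : s % p = t % p) :
    periodicExt V p s = periodicExt V p t := by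
  simp only [periodicExt, h]

lemma periodicExt_natCast {V : List α} {p N : ℕ} (h : HasPeriod V p N) (t : ℕ) (ht : t < N) :
    periodicExt V p t = V[t]? := by
  rw [h.eq_mod t ht, periodicExt]
  norm_cast

lemma endKey_eq_periodicExt {V : List α} {p N : ℕ} (h : HasPeriod V p N) (k : ℕ)
    (hk : V.length ≤ k + N) : endKey V p k = periodicExt V p (V.length - 1 - k) := by
  unfold endKey
  split_ifs with hlt
  · rw [← periodicExt_natCast h _ (by omega)]
    congr 1; omega
  · rfl

/-- Read from the end, the two words agree until the suffix is exhausted; from there on both follow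
the same periodic sequence, since the first `p` letters of the suffix still lie in the periodic
prefix. -/
lemma endKey_drop {V : List α} {p a : ℕ} (hp : 1 ≤ p) (h : HasPeriod V p (a + p))
    (ha : a + p ≤ V.length) : endKey (V.drop a) p = endKey V p := by
  funext k
  have hlen : (V.drop a).length = V.length - a := List.length_drop
  rcases Nat.lt_or_ge k (V.length - a) with hk | hk
  · rw [endKey, endKey, if_pos (by omega), if_pos (by omega), List.getElem?_drop]
    congr 1; omega
  · rw [endKey_eq_periodicExt h k (by omega), endKey, if_neg (by omega)]
    have hp0 : (p : ℤ) ≠ 0 := by omega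
    have h1 := Int.emod_nonneg (((V.drop a).length : ℤ) - 1 - k) hp0
    have h2 := Int.emod_lt_of_pos (((V.drop a).length : ℤ) - 1 - k) (show (0 : ℤ) < p by omega)
    rw [periodicExt, List.getElem?_drop, ← periodicExt_natCast h _ (by omega)]
    apply periodicExt_congr
    push_cast
    rw [Int.toNat_of_nonneg h1, Int.add_emod_emod]
    congr 1
    omega

/-- The palindromic prefix contains a full period, so its reflection symmetry passes to the whole
two-sided sequence. -/
lemma periodicExt_symm {V : List α} {p a : ℕ} (hp : 1 ≤ p) (hpa : p ≤ a) (ha : PalPrefix V a)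
    (h : HasPeriod V p a) (t : ℤ) : periodicExt V p t = periodicExt V p (a - 1 - t) := by
  have hp0 : (p : ℤ) ≠ 0 := by omega
  have h1 := Int.emod_nonneg t hp0
  have h2 := Int.emod_lt_of_pos t (show (0 : ℤ) < p by omega)
  rw [periodicExt, ha.2 _ (by omega), ← periodicExt_natCast h _ (by omega)]
  apply periodicExt_congr
  rw [show ((a - 1 - (t % p).toNat : ℕ) : ℤ) = a - 1 - t % p by omega]
  rw [Int.sub_emod, Int.emod_emod, ← Int.sub_emod]

lemma periodicExt_eq_of_endKey_eq {V V' : List α} {p : ℕ} (hp : 1 ≤ p)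
    (h : endKey V p = endKey V' p) (t : ℤ) :
    periodicExt V p (V.length - 1 - t) = periodicExt V' p (V'.length - 1 - t) := by
  -- Move `t` by a multiple of `p` to an index beyond both words, where the keys are purely
  -- periodic.
  obtain ⟨k, hk⟩ : ∃ k : ℕ, (k : ℤ) = t + p * (|t| + V.length + V'.length) := by
    refine ⟨(t + p * (|t| + V.length + V'.length)).toNat, Int.toNat_of_nonneg ?_⟩
    have : (1 : ℤ) ≤ p := by exact_mod_cast hp
    have := neg_abs_le t
    nlinarith [abs_nonneg t]
  have hge : V.length ≤ k ∧ V'.length ≤ k := by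
    have : (1 : ℤ) ≤ p := by exact_mod_cast hp
    have := neg_abs_le t
    constructor <;> zify <;> nlinarith [abs_nonneg t]
  have hV : ∀ U : List α, U.length ≤ k →
      endKey U p k = periodicExt U p (U.length - 1 - t) := by
    intro U hU
    rw [endKey, if_neg (by omega)]
    apply periodicExt_congr
    rw [hk, show (U.length : ℤ) - 1 - (t + p * (|t| + V.length + V'.length)) =
      U.length - 1 - t + p * (-(|t| + V.length + V'.length)) by ring, Int.add_mul_emod_self_left]
  rw [← hV V hge.1, ← hV V' hge.2, h]

lemma length_unfold (V : List α) (a : ℕ) : (unfold V a).length = V.length - a + V.length := by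
  simp [unfold]

/-- The length of an unfolded palindrome modulo the period is determined by the key. -/
lemma length_unfold_modEq {V V' : List α} {a a' p : ℕ} (h : Extends V a p) (h' : Extends V' a' p)
    (hkey : endKey V p = endKey V' p) :
    (unfold V a).length ≡ (unfold V' a').length [MOD p] := by
  obtain ⟨hpal, ⟨hp, hper, hmin⟩, hpa, -, -⟩ := h
  obtain ⟨hpal', ⟨-, hper', -⟩, hpa', -, -⟩ := h'
  have hp0 : (p : ℤ) ≠ 0 := by omega
  set s : ℤ := 2 * V.length - a with hs
  set s' : ℤ := 2 * V'.length - a' with hs'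
  -- Equal keys align the two periodic sequences at the ends of the words. There the reflections
  -- coming from `a` and from `a'` compose to a translation by the difference `s' - s` of the
  -- unfolded lengths.
  have hshift' : ∀ i : ℤ, periodicExt V p i = periodicExt V p (i - (s' - s)) := by
    intro i
    have e1 := periodicExt_eq_of_endKey_eq hp hkey (V.length - 1 - i + (s' - s))
    rw [periodicExt_symm hp hpa' hpal' hper'] at e1
    rw [periodicExt_symm hp hpa hpal hper]
    have e2 := periodicExt_eq_of_endKey_eq hp hkey (V.length - a + i)
    rw [show (V.length : ℤ) - 1 - (V.length - a + i) = a - 1 - i by ring] at e2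
    rw [show (V.length : ℤ) - 1 - (V.length - 1 - i + (s' - s)) = i - (s' - s) by ring] at e1
    rw [e1, e2]
    congr 1
    rw [hs, hs']; ring
  have hshift : ∀ i : ℤ, periodicExt V p i = periodicExt V p (i + (s' - s)) := by
    intro i
    rw [hshift' (i + (s' - s)), add_sub_cancel_right]
  have hd0 := Int.emod_nonneg (s' - s) hp0
  have hdp := Int.emod_lt_of_pos (s' - s) (show (0 : ℤ) < p by omega)
  -- A nonzero remainder would be a period smaller than the least one.
  have hzero : (s' - s) % p = 0 := by
    by_contra hne
    have := hmin ((s' - s) % p).toNat (by omega) (by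
      intro i hi
      rw [← periodicExt_natCast hper i (by omega), ← periodicExt_natCast hper _ hi, hshift]
      apply periodicExt_congr
      push_cast
      rw [Int.toNat_of_nonneg hd0, Int.add_emod_emod])
    omega
  rw [← Int.natCast_modEq_iff]
  have hl : ((unfold V a).length : ℤ) = s := by
    rw [length_unfold]; have := hpal.1; omega
  have hl' : ((unfold V' a').length : ℤ) = s' := by
    rw [length_unfold]; have := hpal'.1; omega
  rw [hl, hl', Int.modEq_iff_dvd]
  exact Int.dvd_of_emod_eq_zero hzero

lemma unfold_getElem? (V : List α) (p : ℕ) {a k : ℕ} (hk : k < V.length) :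
    (unfold V a)[(unfold V a).length - 1 - k]? = endKey V p k := by
  rw [endKey, if_pos hk, length_unfold, unfold, List.getElem?_append_right (by simp; omega)]
  congr 1
  simp; omega

lemma getElem?_eq_of_palindrome {W : List α} (h : W = W.reverse) {i : ℕ} (hi : i < W.length) :
    W[i]? = W[W.length - 1 - i]? := by
  conv_lhs => rw [h]
  rw [List.getElem?_reverse hi]

/-- An unfolded palindrome is determined by its length and its key. -/
lemma unfold_eq_of_endKey_eq {V V' : List α} {a a' p : ℕ}
    (hW : unfold V a = (unfold V a).reverse) (hW' : unfold V' a' = (unfold V' a').reverse)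
    (hkey : endKey V p = endKey V' p) (hlen : (unfold V a).length = (unfold V' a').length) :
    unfold V a = unfold V' a' := by
  have l1 := length_unfold V a
  have l2 := length_unfold V' a'
  -- The last half of the unfolded word lies inside `V`, where the key records it; the palindrome
  -- property supplies the other half.
  have key : ∀ k, 2 * k < (unfold V a).length →
      (unfold V a)[(unfold V a).length - 1 - k]? =
        (unfold V' a')[(unfold V' a').length - 1 - k]? := by
    intro k hk
    rw [unfold_getElem? V p (by omega), unfold_getElem? V' p (by omega), hkey]
  apply List.ext_getElem?
  intro i
  rcases Nat.lt_or_ge i (unfold V a).length with hi | hi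
  · rcases Nat.lt_or_ge (2 * i) (unfold V a).length with h2 | h2
    · rw [getElem?_eq_of_palindrome hW hi, getElem?_eq_of_palindrome hW' (by omega), key i h2]
    · have := key ((unfold V a).length - 1 - i) (by omega)
      rwa [← hlen, show (unfold V a).length - 1 - ((unfold V a).length - 1 - i) = i by omega]
        at this
  · rw [List.getElem?_eq_none hi, List.getElem?_eq_none (by omega)]

/-- A smaller period of the cube would hold on a window of length `p`, hence on the whole periodic
prefix, contradicting minimality on the prefix of length `a`. The same argument with a window
starting at `a` treats `V.drop a`; thus both halves of the palindrome are counted under `p`. -/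
lemma Extends.isMinPeriod_self {V : List α} {a p : ℕ} (h : Extends V a p) :
    IsMinPeriod V p (3 * p) := by
  obtain ⟨-, ⟨hp, hper, hmin⟩, hpa, hlen, hext⟩ := h
  refine ⟨hp, hext.mono (by omega), fun d hd hd' => ?_⟩
  by_contra hlt
  refine hlt (hmin d hd (HasPeriod.mono ?_ (Nat.le_add_right a (3 * p))))
  exact hext.of_window (m := 0) hp (by omega) fun j _ hj => hd' j (by omega)

lemma Extends.isMinPeriod_drop {V : List α} {a p : ℕ} (h : Extends V a p) :
    IsMinPeriod (V.drop a) p (3 * p) := by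
  obtain ⟨-, ⟨hp, hper, hmin⟩, hpa, hlen, hext⟩ := h
  refine ⟨hp, fun i hi => ?_, fun d hd hd' => ?_⟩
  · rw [List.getElem?_drop, List.getElem?_drop, hext (a + i) (by omega), add_assoc]
  by_contra hlt
  refine hlt (hmin d hd (HasPeriod.mono ?_ (Nat.le_add_right a (3 * p))))
  refine hext.of_window (m := a) hp (by omega) fun j hj hj' => ?_
  have := hd' (j - a) (by omega)
  rw [List.getElem?_drop, List.getElem?_drop] at this
  rwa [show a + (j - a) = j by omega, show a + (j - a + d) = j + d by omega] at this

lemma Extends.endKey_drop {V : List α} {a p : ℕ} (h : Extends V a p) :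
    endKey (V.drop a) p = endKey V p := by
  obtain ⟨-, ⟨hp, -, -⟩, -, hlen, hext⟩ := h
  exact LabelledTree.endKey_drop hp (hext.mono (by omega)) (by omega)

/-- A palindrome `U.reverse ++ V` with `U` no longer than `V` is an unfolding of `V`. -/
lemma exists_unfold_of_palindrome {U V : List α} (hUV : U.length ≤ V.length)
    (h : U.reverse ++ V = (U.reverse ++ V).reverse) :
    ∃ a, PalPrefix V a ∧ V.drop a = U ∧ U.reverse ++ V = unfold V a := by
  set a := V.length - U.length with ha
  have h2 : U.reverse ++ (V.take a ++ V.drop a) =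
      (V.drop a).reverse ++ ((V.take a).reverse ++ U) := by
    rw [List.take_append_drop, h, List.reverse_append, List.reverse_reverse, ← List.append_assoc,
      ← List.reverse_append, List.take_append_drop]
  obtain ⟨h3, h4⟩ := List.append_inj h2 (by simp; omega)
  obtain ⟨h5, h6⟩ := List.append_inj h4 (by simp)
  refine ⟨a, ⟨by omega, fun i hi => ?_⟩, h6, by rw [unfold, h6]⟩
  have hlen : (V.take a).length = a := by simp; omega
  have := getElem?_eq_of_palindrome h5 (i := i) (by omega)
  rwa [hlen, List.getElem?_take_of_lt hi, List.getElem?_take_of_lt (by omega)] at this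

/-- The count is logarithmic, but `√n` per word is all the final bound needs. -/
lemma card_not_extends_le {n : ℕ} (hn : 1 ≤ n) {V : List α} {X : Finset ℕ}
    (hX : ∀ a ∈ X, a ≤ n ∧ PalPrefix V a ∧ ∀ p, ¬ Extends V a p) : (X.card : ℝ) ≤ 13 * √n := by
  have h1 := card_le_log_of_growth (fun a ha => (hX a ha).1)
    (fun a ha b hb c hc e he hab hbc hce => growth_of_not_extends (hX a ha).2.1 (hX b hb).2.1
      (hX c hc).2.1 (hX e he).2.1 hab hbc hce (hX a ha).2.2)
  have h2 : (X.card : ℝ) ≤ 6 * (Nat.log 2 n + 1) + 1 := by exact_mod_cast h1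
  have h3 := log_two_add_one_le_sqrt hn
  have h4 : (1 : ℝ) ≤ √n := by rw [Real.one_le_sqrt]; exact_mod_cast hn
  linarith

/-- One residue class modulo `p` has at most `2 * n / p + 1` members up to `2 * n`, and `1 ≤ n / p`.
-/
lemma card_le_of_modEq {n p : ℕ} (hp : 1 ≤ p) (hpn : p ≤ n) {X : Finset (List α)}
    (hlen : ∀ W ∈ X, W.length ≤ 2 * n)
    (hmod : ∀ W ∈ X, ∀ W' ∈ X, W.length ≡ W'.length [MOD p])
    (hinj : ∀ W ∈ X, ∀ W' ∈ X, W.length = W'.length → W = W') :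
    (X.card : ℝ) ≤ 3 * n / p := by
  have h1 : X.card ≤ 2 * n / p + 1 := by
    rw [← Finset.card_range (2 * n / p + 1)]
    apply Finset.card_le_card_of_injOn (fun W => W.length / p)
    · intro W hW
      have := Nat.div_le_div_right (c := p) (hlen W hW)
      simp only [Finset.coe_range, Set.mem_Iio]; omega
    · intro W hW W' hW' h
      apply hinj W hW W' hW'
      have hm : W.length % p = W'.length % p := hmod W hW W' hW'
      simp only at h
      rw [← Nat.div_add_mod W.length p, ← Nat.div_add_mod W'.length p, h, hm]
  have h2 : (X.card : ℝ) ≤ ((2 * n / p : ℕ) : ℝ) + 1 := by exact_mod_cast h1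
  have h3 : ((2 * n / p : ℕ) : ℝ) ≤ 2 * n / p := by
    have := Nat.cast_div_le (α := ℝ) (m := 2 * n) (n := p)
    push_cast at this; exact this
  have hp' : (0 : ℝ) < p := by exact_mod_cast hp
  have h4 : (1 : ℝ) ≤ n / p := by rw [le_div_iff₀ hp']; simpa using hpn
  have h5 : (3 * n / p : ℝ) = 2 * n / p + n / p := by ring
  linarith

/-- The number of unfolded palindromes with an extending period. -/
lemma card_extends_le {n : ℕ} (L : Finset (List α)) (hL : L.card ≤ n)
    (hlen : ∀ V ∈ L, V.length ≤ n) (S : Finset (List α)) (hpal : ∀ W ∈ S, W = W.reverse)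
    (hS : ∀ W ∈ S, ∃ V ∈ L, ∃ a p, Extends V a p ∧ V.drop a ∈ L ∧ W = unfold V a) :
    (S.card : ℝ) ≤ 7 * (n * √n) := by
  classical
  set P : List α → Finset ℕ := fun V => (Finset.Icc 1 n).filter fun p => IsMinPeriod V p (3 * p)
    with hP
  set M : Finset (Σ _ : List α, ℕ) := L.sigma P with hM
  set key : (Σ _ : List α, ℕ) → ℕ × (ℕ → Option α) := fun m => (m.2, endKey m.1 m.2) with hkey
  set fib : ℕ × (ℕ → Option α) → Finset (Σ _ : List α, ℕ) := fun κ => M.filter (fun m => key m = κ)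
    with hfib
  set X : ℕ × (ℕ → Option α) → Finset (List α) := fun κ => S.filter fun W =>
    ∃ V ∈ L, ∃ a, Extends V a κ.1 ∧ V.drop a ∈ L ∧ endKey V κ.1 = κ.2 ∧ W = unfold V a with hXdef
  have hmemM : ∀ V ∈ L, ∀ a p, Extends V a p → V.drop a ∈ L →
      (⟨V, p⟩ : Σ _ : List α, ℕ) ∈ M ∧ (⟨V.drop a, p⟩ : Σ _ : List α, ℕ) ∈ M := by
    intro V hV a p h hU
    have hpn : p ≤ n := by
      have := hlen V hV
      have := h.2.2.2.1
      omega
    have hp : p ∈ Finset.Icc 1 n := Finset.mem_Icc.2 ⟨h.2.1.1, hpn⟩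
    exact ⟨Finset.mem_sigma.2 ⟨hV, Finset.mem_filter.2 ⟨hp, h.isMinPeriod_self⟩⟩,
      Finset.mem_sigma.2 ⟨hU, Finset.mem_filter.2 ⟨hp, h.isMinPeriod_drop⟩⟩⟩
  have hcover : S ⊆ (M.image key).biUnion X := by
    intro W hW
    obtain ⟨V, hV, a, p, h, hU, rfl⟩ := hS W hW
    refine Finset.mem_biUnion.2 ⟨key ⟨V, p⟩, Finset.mem_image_of_mem _ (hmemM V hV a p h hU).1,
      Finset.mem_filter.2 ⟨hW, V, hV, a, h, hU, rfl, rfl⟩⟩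
  -- Both halves `V.drop a` and `V` have the key `κ`, so the palindrome comes from a pair in the
  -- fibre.
  have hsq : ∀ κ, (X κ).card ≤ (fib κ).card * (fib κ).card := by
    intro κ
    rw [← Finset.card_product]
    refine le_trans (Finset.card_le_card ?_)
      (Finset.card_image_le (f := fun m => m.1.1.reverse ++ m.2.1))
    intro W hW
    obtain ⟨-, V, hV, a, h, hU, hk, rfl⟩ := Finset.mem_filter.1 hW
    obtain ⟨m1, m2⟩ := hmemM V hV a _ h hU
    refine Finset.mem_image.2 ⟨(⟨V.drop a, κ.1⟩, ⟨V, κ.1⟩), Finset.mem_product.2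
      ⟨Finset.mem_filter.2 ⟨m2, ?_⟩, Finset.mem_filter.2 ⟨m1, ?_⟩⟩, rfl⟩
    · exact Prod.ext rfl (h.endKey_drop.trans hk)
    · exact Prod.ext rfl hk
  have hlin : ∀ κ ∈ M.image key, ((X κ).card : ℝ) ≤ 3 * n / κ.1 := by
    intro κ hκ
    obtain ⟨m, hm, rfl⟩ := Finset.mem_image.1 hκ
    have hp := Finset.mem_Icc.1 (Finset.mem_filter.1 (Finset.mem_sigma.1 hm).2).1
    apply card_le_of_modEq hp.1 hp.2
    · intro W hW
      obtain ⟨-, V, hV, a, -, -, -, rfl⟩ := Finset.mem_filter.1 hW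
      have := hlen V hV
      rw [length_unfold]; omega
    · intro W hW W' hW'
      obtain ⟨-, V, hV, a, h, -, hk, rfl⟩ := Finset.mem_filter.1 hW
      obtain ⟨-, V', hV', a', h', -, hk', rfl⟩ := Finset.mem_filter.1 hW'
      exact length_unfold_modEq h h' (hk.trans hk'.symm)
    · intro W hW W' hW' hl
      obtain ⟨hWS, V, hV, a, h, -, hk, rfl⟩ := Finset.mem_filter.1 hW
      obtain ⟨hWS', V', hV', a', h', -, hk', rfl⟩ := Finset.mem_filter.1 hW'
      exact unfold_eq_of_endKey_eq (hpal _ hWS) (hpal _ hWS') (hk.trans hk'.symm) hl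
  -- Geometric mean of the quadratic and the linear bound, written as a sum over the fibre so that
  -- the fibres add up to a sum over `M`.
  have hX : ∀ κ ∈ M.image key, ((X κ).card : ℝ) ≤ ∑ m ∈ fib κ, √(3 * n) * (√(m.2 : ℝ))⁻¹ := by
    intro κ hκ
    have h1 : ∑ m ∈ fib κ, √(3 * n) * (√(m.2 : ℝ))⁻¹ = (fib κ).card * √(3 * n / κ.1) := by
      rw [← nsmul_eq_mul]
      apply Finset.sum_eq_card_nsmul
      intro m hm
      have : m.2 = κ.1 := by rw [← (Finset.mem_filter.1 hm).2]
      rw [this, Real.sqrt_div' _ (by positivity), div_eq_mul_inv]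
    rw [h1]
    apply le_of_sq_le_sq _ (by positivity)
    rw [mul_pow, Real.sq_sqrt (by positivity), sq, sq]
    have h2 : ((X κ).card : ℝ) ≤ (fib κ).card * (fib κ).card := by exact_mod_cast hsq κ
    exact mul_le_mul h2 (hlin κ hκ) (by positivity) (by positivity)
  have hsum : ∀ V ∈ L, ∑ p ∈ P V, √(3 * n) * (√(p : ℝ))⁻¹ ≤ √(3 * n) * 4 := by
    intro V _
    rw [← Finset.mul_sum]
    apply mul_le_mul_of_nonneg_left _ (by positivity)
    apply sum_inv_sqrt_le
    · intro p hp
      exact (Finset.mem_Icc.1 (Finset.mem_filter.1 hp).1).1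
    · intro p hp q hq hpq
      exact two_mul_lt_of_isMinPeriod (Finset.mem_filter.1 hp).2 (Finset.mem_filter.1 hq).2 hpq
  have hsqrt3 : √(3 * n : ℝ) ≤ 7 / 4 * √n := by
    rw [Real.sqrt_mul (by norm_num)]
    apply mul_le_mul_of_nonneg_right _ (by positivity)
    rw [Real.sqrt_le_left (by norm_num)]
    norm_num
  calc (S.card : ℝ) ≤ ∑ κ ∈ M.image key, ((X κ).card : ℝ) := by
        exact_mod_cast (Finset.card_le_card hcover).trans Finset.card_biUnion_le
    _ ≤ ∑ κ ∈ M.image key, ∑ m ∈ fib κ, √(3 * n) * (√(m.2 : ℝ))⁻¹ := Finset.sum_le_sum hX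
    _ = ∑ m ∈ M, √(3 * n) * (√(m.2 : ℝ))⁻¹ :=
        Finset.sum_fiberwise_of_maps_to (fun m hm => Finset.mem_image_of_mem _ hm) _
    _ = ∑ V ∈ L, ∑ p ∈ P V, √(3 * n) * (√(p : ℝ))⁻¹ := by rw [hM, Finset.sum_sigma]
    _ ≤ ∑ _V ∈ L, √(3 * n) * 4 := Finset.sum_le_sum hsum
    _ = L.card * (√(3 * n) * 4) := by rw [Finset.sum_const, nsmul_eq_mul]
    _ ≤ n * (7 / 4 * √n * 4) := by
        have : (L.card : ℝ) ≤ n := by exact_mod_cast hL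
        gcongr
    _ = 7 * (n * √n) := by ring

/-- A set of `n` words of length at most `n` gives rise to `O(n ^ (3 / 2))` palindromes of the
form `U.reverse ++ V`. -/
theorem card_palindromes_le {n : ℕ} (hn : 1 ≤ n) (L : Finset (List α)) (hL : L.card ≤ n)
    (hlen : ∀ V ∈ L, V.length ≤ n) (S : Finset (List α))
    (hS : ∀ W ∈ S, W = W.reverse ∧ ∃ U ∈ L, ∃ V ∈ L, W = U.reverse ++ V) :
    (S.card : ℝ) ≤ 20 * (n * √n) := by
  classical
  have hunfold : ∀ W ∈ S, ∃ V ∈ L, ∃ a, PalPrefix V a ∧ V.drop a ∈ L ∧ W = unfold V a := by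
    intro W hW
    obtain ⟨hrev, U, hU, V, hV, rfl⟩ := hS W hW
    rcases le_total U.length V.length with h | h
    · obtain ⟨a, ha, h1, h2⟩ := exists_unfold_of_palindrome h hrev
      exact ⟨V, hV, a, ha, h1 ▸ hU, h2⟩
    -- Reversing the palindrome exchanges the roles of `U` and `V`.
    · have hrev' : V.reverse ++ U = (V.reverse ++ U).reverse := by
        have : V.reverse ++ U = (U.reverse ++ V).reverse := by simp
        rw [this, ← hrev, ← hrev]
      obtain ⟨a, ha, h1, h2⟩ := exists_unfold_of_palindrome h hrev'
      refine ⟨U, hU, a, ha, h1 ▸ hV, ?_⟩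
      rw [← h2, hrev]; simp
  set good : List α → Prop := fun W =>
    ∃ V ∈ L, ∃ a p, Extends V a p ∧ V.drop a ∈ L ∧ W = unfold V a with hgood
  set B : List α → Finset ℕ := fun V => (Finset.range (n + 1)).filter fun a =>
    PalPrefix V a ∧ ∀ p, ¬ Extends V a p with hB
  have h1 := card_extends_le L hL hlen (S.filter good)
    (fun W hW => (hS W (Finset.mem_filter.1 hW).1).1) (fun W hW => (Finset.mem_filter.1 hW).2)
  have hcover : S.filter (fun W => ¬ good W) ⊆ L.biUnion fun V => (B V).image (unfold V) := by
    intro W hW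
    obtain ⟨hWS, hng⟩ := Finset.mem_filter.1 hW
    obtain ⟨V, hV, a, ha, hU, rfl⟩ := hunfold W hWS
    refine Finset.mem_biUnion.2 ⟨V, hV, Finset.mem_image_of_mem _ (Finset.mem_filter.2 ⟨?_, ha, ?_⟩)⟩
    · have := ha.1
      have := hlen V hV
      exact Finset.mem_range.2 (by omega)
    · intro p hp
      exact hng ⟨V, hV, a, p, hp, hU, rfl⟩
  have h2 : ((S.filter fun W => ¬ good W).card : ℝ) ≤ 13 * (n * √n) := by
    calc ((S.filter fun W => ¬ good W).card : ℝ)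
        ≤ ∑ V ∈ L, (((B V).image (unfold V)).card : ℝ) := by
          exact_mod_cast (Finset.card_le_card hcover).trans Finset.card_biUnion_le
      _ ≤ ∑ _V ∈ L, 13 * √n := by
          apply Finset.sum_le_sum
          intro V _
          refine le_trans (by exact_mod_cast Finset.card_image_le)
            (card_not_extends_le (V := V) (X := B V) hn ?_)
          intro a ha
          obtain ⟨h, h'⟩ := Finset.mem_filter.1 ha
          exact ⟨by have := Finset.mem_range.1 h; omega, h'⟩
      _ = L.card * (13 * √n) := by rw [Finset.sum_const, nsmul_eq_mul]
      _ ≤ n * (13 * √n) := by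
          have : (L.card : ℝ) ≤ n := by exact_mod_cast hL
          gcongr
      _ = 13 * (n * √n) := by ring
  have h3 : (S.card : ℝ) = (S.filter good).card + (S.filter fun W => ¬ good W).card := by
    exact_mod_cast (Finset.card_filter_add_card_filter_not (s := S) good).symm
  linarith

end Counting

end LabelledTree

namespace LabelledTree

open SimpleGraph

/-! ### Centroid decomposition and the upper bound -/

section Upper

variable {V : Type v} {α : Type u} {G : SimpleGraph V}

/-- The palindromes read along simple paths inside the vertex set `S`. -/
def palsWithin (G : SimpleGraph V) (lab : Sym2 V → α) (S : Finset V) : Set (List α) :=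
  {W | W = W.reverse ∧ ∃ (x y : V) (p : G.Walk x y), p.IsPath ∧ (∀ v ∈ p.support, v ∈ S) ∧
    label lab p = W}

/-- The neighbour of `r` through which `v` is reached from `r` is unique in a tree. -/
lemma eq_of_adj_of_dist_lt (hG : G.IsTree) {r s s' v : V} (hs : G.Adj r s) (hs' : G.Adj r s')
    (h : G.dist s v < G.dist r v) (h' : G.dist s' v < G.dist r v) : s = s' := by
  have key : ∀ {s : V} (_ : G.Adj r s), G.dist s v < G.dist r v →
      ∃ p : G.Walk r v, p.IsPath ∧ p.snd = s := by
    intro s hs h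
    obtain ⟨q, -, hq⟩ := hG.connected.exists_path_of_dist s v
    refine ⟨Walk.cons hs q, Walk.isPath_of_length_eq_dist _ ?_, by simp⟩
    have := dist_le (Walk.cons hs q)
    rw [Walk.length_cons] at this ⊢
    omega
  obtain ⟨p, hp, rfl⟩ := key hs h
  obtain ⟨p', hp', rfl⟩ := key hs' h'
  rw [(hG.existsUnique_path r v).unique hp hp']

lemma exists_adj_dist_lt (hG : G.IsTree) {r v : V} (hv : v ≠ r) :
    ∃ s, G.Adj r s ∧ G.dist s v < G.dist r v := by
  obtain ⟨p, -, hp⟩ := hG.connected.exists_path_of_dist r v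
  cases p with
  | nil => exact absurd rfl hv
  | cons h q =>
    refine ⟨_, h, ?_⟩
    have := dist_le q
    rw [Walk.length_cons] at hp
    omega

/-- Adjacent vertices other than `r` lie in the same branch at `r`. -/
lemma branch_eq_of_adj (hG : G.IsTree) {r : V} {b : V → V}
    (hb : ∀ v, v ≠ r → G.Adj r (b v) ∧ G.dist (b v) v < G.dist r v) {v w : V} (hv : v ≠ r)
    (hw : w ≠ r) (hvw : G.Adj v w) : b v = b w := by
  wlog h : G.dist r w = G.dist r v + 1 generalizing v w
  · refine (this hw hv hvw.symm ?_).symm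
    have := hG.dist_eq_dist_add_one_of_adj r hvw
    omega
  refine eq_of_adj_of_dist_lt hG (hb v hv).1 (hb w hw).1 ?_ (hb w hw).2
  have h1 := hG.dist_eq_dist_add_one_of_adj (b v) hvw
  have := (hb v hv).2
  omega

lemma branch_eq_of_walk (hG : G.IsTree) {r : V} {b : V → V}
    (hb : ∀ v, v ≠ r → G.Adj r (b v) ∧ G.dist (b v) v < G.dist r v) {x y : V} (p : G.Walk x y)
    (hr : r ∉ p.support) : ∀ v ∈ p.support, b v = b x := by
  induction p with
  | nil => simp
  | @cons x w y h q ih =>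
    rw [Walk.support_cons, List.mem_cons, not_or] at hr
    intro v hv
    rw [Walk.support_cons, List.mem_cons] at hv
    rcases hv with rfl | hv
    · rfl
    · rw [ih hr.2 v hv]
      refine (branch_eq_of_adj hG hb (Ne.symm hr.1) ?_ h).symm
      rintro rfl
      exact hr.2 q.start_mem_support

/-- Every finite set of vertices of a tree has a centroid. -/
lemma exists_centroid (hG : G.IsTree) (S : Finset V) :
    ∃ r : V, ∀ s, G.Adj r s → 2 * (S.filter fun v => G.dist s v < G.dist r v).card ≤ S.card := by
  classical
  have := hG.connected.nonempty
  -- Take `r` minimising the total distance to `S`. Moving to a neighbour `s` gains `1` for each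
  -- vertex in the branch of `s` and loses `1` for every other, so that branch holds at most half of
  -- `S`.
  obtain ⟨r, hr⟩ : ∃ r, ∀ s, ∑ v ∈ S, G.dist r v ≤ ∑ v ∈ S, G.dist s v := by
    refine ⟨Function.argmin fun r => ∑ v ∈ S, G.dist r v, fun s => ?_⟩
    exact Function.argmin_le (fun r => ∑ v ∈ S, G.dist r v) s
  refine ⟨r, fun s hs => ?_⟩
  have h1 := Finset.card_filter_add_card_filter_not (s := S) (fun v => G.dist s v < G.dist r v)
  have h2 : ∑ v ∈ S, (G.dist s v + if G.dist s v < G.dist r v then 1 else 0) =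
      ∑ v ∈ S, (G.dist r v + if ¬ G.dist s v < G.dist r v then 1 else 0) := by
    apply Finset.sum_congr rfl
    intro v _
    have := hG.dist_eq_dist_add_one_of_adj v hs
    rw [G.dist_comm (u := v), G.dist_comm (u := v)] at this
    split_ifs <;> omega
  rw [Finset.sum_add_distrib, Finset.sum_add_distrib, ← Finset.card_filter,
    ← Finset.card_filter] at h2
  have := hr s
  omega

lemma length_label (lab : Sym2 V → α) {x y : V} (p : G.Walk x y) :
    (label lab p).length = p.length := by
  simp [label]

/-- Palindromes read along paths through a fixed vertex. -/
lemma card_pals_through_le (hG : G.IsTree) (lab : Sym2 V → α) (r : V) {S : Finset V}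
    (hS : 1 ≤ S.card) (T : Finset (List α))
    (hT : ∀ W ∈ T, W = W.reverse ∧ ∃ (x y : V) (p : G.Walk x y), p.IsPath ∧
      (∀ v ∈ p.support, v ∈ S) ∧ r ∈ p.support ∧ label lab p = W) :
    (T.card : ℝ) ≤ 20 * (S.card * √S.card) := by
  classical
  choose pth hpth using fun v => (hG.existsUnique_path r v).exists
  -- `S` need not be connected, so paths from `r` may leave it and be long. Those that matter are
  -- pieces of a path inside `S` and survive the filter.
  set L := (S.image fun v => label lab (pth v)).filter fun U => U.length ≤ S.card with hL
  apply card_palindromes_le hS L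
  · exact (Finset.card_filter_le _ _).trans Finset.card_image_le
  · intro U hU
    exact (Finset.mem_filter.1 hU).2
  · intro W hW
    obtain ⟨hrev, x, y, p, hp, hpS, hr, rfl⟩ := hT W hW
    refine ⟨hrev, ?_⟩
    have hlen : p.length ≤ S.card := by
      have h1 : p.support.toFinset ⊆ S := fun v hv => hpS v (List.mem_toFinset.1 hv)
      have h2 := Finset.card_le_card h1
      rw [List.toFinset_card_of_nodup hp.support_nodup, Walk.length_support] at h2
      omega
    have hsum : (p.takeUntil r hr).length + (p.dropUntil r hr).length = p.length := by
      rw [← Walk.length_append, Walk.take_spec]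
    have e1 : pth x = (p.takeUntil r hr).reverse :=
      (hG.existsUnique_path r x).unique (hpth x) (hp.takeUntil hr).reverse
    have e2 : pth y = p.dropUntil r hr :=
      (hG.existsUnique_path r y).unique (hpth y) (hp.dropUntil hr)
    refine ⟨label lab (pth x), ?_, label lab (pth y), ?_, ?_⟩
    · refine Finset.mem_filter.2 ⟨Finset.mem_image_of_mem _ (hpS x p.start_mem_support), ?_⟩
      rw [length_label, e1, Walk.length_reverse]; omega
    · refine Finset.mem_filter.2 ⟨Finset.mem_image_of_mem _ (hpS y p.end_mem_support), ?_⟩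
      rw [length_label, e2]; omega
    · simp only [label, e1, e2, Walk.edges_reverse, List.map_reverse, List.reverse_reverse]
      rw [← List.map_append, ← Walk.edges_append, Walk.take_spec]

/-- The number of palindromes read along paths inside a set of vertices of a tree. -/
theorem card_palsWithin_le (hG : G.IsTree) (lab : Sym2 V → α) (S : Finset V) :
    ∀ T : Finset (List α), (∀ W ∈ T, W ∈ palsWithin G lab S) →
      (T.card : ℝ) ≤ 80 * (S.card * √S.card) := by
  classical
  induction S using Finset.strongInduction with
  | H S ih =>
  intro T hT
  rcases S.eq_empty_or_nonempty with rfl | hne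
  · rw [Finset.eq_empty_of_forall_notMem (s := T)]
    · simp
    · intro W hW
      obtain ⟨-, x, y, p, -, hp, -⟩ := hT W hW
      exact absurd (hp x p.start_mem_support) (Finset.notMem_empty x)
  have hS : 1 ≤ S.card := hne.card_pos
  obtain ⟨r, hr⟩ := exists_centroid hG S
  have hex : ∀ v, ∃ s, v ≠ r → G.Adj r s ∧ G.dist s v < G.dist r v := by
    intro v
    by_cases hv : v = r
    · exact ⟨v, fun h => absurd hv h⟩
    · obtain ⟨s, hs⟩ := exists_adj_dist_lt hG hv
      exact ⟨s, fun _ => hs⟩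
  choose b hb using hex
  set S' := S.filter (fun v => v ≠ r) with hS'
  set part : V → Finset V := fun s => S'.filter (fun v => b v = s) with hpart
  have hhalf : ∀ s ∈ S'.image b, 2 * (part s).card ≤ S.card := by
    intro s hs
    obtain ⟨v, hv, rfl⟩ := Finset.mem_image.1 hs
    refine le_trans (Nat.mul_le_mul_left 2 (Finset.card_le_card ?_))
      (hr _ (hb v (Finset.mem_filter.1 hv).2).1)
    intro w hw
    obtain ⟨hw1, hw2⟩ := Finset.mem_filter.1 hw
    obtain ⟨hwS, hwr⟩ := Finset.mem_filter.1 hw1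
    exact Finset.mem_filter.2 ⟨hwS, hw2 ▸ (hb w hwr).2⟩
  set thr : List α → Prop := fun W => ∃ (x y : V) (p : G.Walk x y), p.IsPath ∧
      (∀ v ∈ p.support, v ∈ S) ∧ r ∈ p.support ∧ label lab p = W with hthr
  have h1 := card_pals_through_le hG lab r hS (T.filter thr)
    (fun W hW => ⟨(hT W (Finset.mem_filter.1 hW).1).1, (Finset.mem_filter.1 hW).2⟩)
  have hcover : T.filter (fun W => ¬ thr W) ⊆
      (S'.image b).biUnion fun s => T.filter fun W => W ∈ palsWithin G lab (part s) := by
    intro W hW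
    obtain ⟨hWT, hnot⟩ := Finset.mem_filter.1 hW
    obtain ⟨hrev, x, y, p, hp, hpS, hlab⟩ := hT W hWT
    have hrp : r ∉ p.support := fun h => hnot ⟨x, y, p, hp, hpS, h, hlab⟩
    have hmem : ∀ v ∈ p.support, v ∈ S' := fun v hv =>
      Finset.mem_filter.2 ⟨hpS v hv, fun h => hrp (h ▸ hv)⟩
    refine Finset.mem_biUnion.2 ⟨b x, Finset.mem_image_of_mem _ (hmem x p.start_mem_support),
      Finset.mem_filter.2 ⟨hWT, hrev, x, y, p, hp, fun v hv => ?_, hlab⟩⟩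
    exact Finset.mem_filter.2 ⟨hmem v hv, branch_eq_of_walk hG hb p hrp v hv⟩
  have hpartcard : ∑ s ∈ S'.image b, ((part s).card : ℝ) ≤ S.card := by
    have h := Finset.card_eq_sum_card_image b S'
    have h' : S'.card ≤ S.card := Finset.card_filter_le _ _
    rw [h] at h'
    exact_mod_cast h'
  have h2 : ((T.filter fun W => ¬ thr W).card : ℝ) ≤ 60 * (S.card * √S.card) := by
    calc ((T.filter fun W => ¬ thr W).card : ℝ)
        ≤ ∑ s ∈ S'.image b, ((T.filter fun W => W ∈ palsWithin G lab (part s)).card : ℝ) := by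
          exact_mod_cast (Finset.card_le_card hcover).trans Finset.card_biUnion_le
      _ ≤ ∑ s ∈ S'.image b, ((part s).card : ℝ) * (60 * √S.card) := by
          apply Finset.sum_le_sum
          intro s hs
          have hsub : part s ⊂ S := by
            refine (Finset.ssubset_iff_subset_ne).2
              ⟨(Finset.filter_subset _ _).trans (Finset.filter_subset _ _), fun h => ?_⟩
            have := hhalf s hs
            rw [h] at this
            omega
          have h3 := ih (part s) hsub (T.filter fun W => W ∈ palsWithin G lab (part s))
            (fun W hW => (Finset.mem_filter.1 hW).2)
          -- `3 / 4` bounds `√(1 / 2)`; the constant `80` solves `20 + (3 / 4) * 80 = 80`.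
          have h4 : √((part s).card : ℝ) ≤ 3 / 4 * √S.card := by
            apply Real.sqrt_le_iff.2 ⟨by positivity, ?_⟩
            rw [mul_pow, Real.sq_sqrt (by positivity)]
            have : (2 * (part s).card : ℝ) ≤ S.card := by exact_mod_cast hhalf s hs
            have : (0 : ℝ) ≤ S.card := by positivity
            linarith
          calc _ ≤ _ := h3
            _ ≤ 80 * ((part s).card * (3 / 4 * √S.card)) := by gcongr
            _ = _ := by ring
      _ = (∑ s ∈ S'.image b, ((part s).card : ℝ)) * (60 * √S.card) := by rw [Finset.sum_mul]
      _ ≤ S.card * (60 * √S.card) := by gcongr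
      _ = _ := by ring
  have h3 : (T.card : ℝ) = (T.filter thr).card + (T.filter fun W => ¬ thr W).card := by
    exact_mod_cast (Finset.card_filter_add_card_filter_not (s := T) thr).symm
  linarith

/-- A tree with `n` edges has `O(n ^ (3 / 2))` palindromic substrings. -/
theorem pals_finite_and_ncard_le [Finite V] (hG : G.IsTree) (lab : Sym2 V → α) {n : ℕ}
    (hn : G.edgeSet.ncard = n) (hn1 : 1 ≤ n) :
    (pals G lab).Finite ∧ ((pals G lab).ncard : ℝ) ≤ 240 * (n * √n) := by
  classical
  have := Fintype.ofFinite V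
  have hcard : Fintype.card V = n + 1 := by
    have := (isTree_iff_connected_and_card.1 hG).2
    rw [Nat.card_coe_set_eq, hn, Nat.card_eq_fintype_card] at this
    exact this.symm
  have hbound : ∀ T : Finset (List α), (∀ W ∈ T, W ∈ pals G lab) →
      (T.card : ℝ) ≤ 240 * (n * √n) := by
    intro T hT
    have h1 := card_palsWithin_le hG lab Finset.univ T (fun W hW => by
      obtain ⟨⟨x, y, p, hp, hl⟩, hrev⟩ := hT W hW
      exact ⟨hrev, x, y, p, hp, fun v _ => Finset.mem_univ v, hl⟩)
    rw [Finset.card_univ, hcard] at h1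
    have hn' : (1 : ℝ) ≤ n := by exact_mod_cast hn1
    have h2 : √((n + 1 : ℕ) : ℝ) ≤ 3 / 2 * √n := by
      apply Real.sqrt_le_iff.2 ⟨by positivity, ?_⟩
      rw [mul_pow, Real.sq_sqrt (by positivity)]
      push_cast; linarith
    have h3 : ((n + 1 : ℕ) : ℝ) ≤ 2 * n := by push_cast; linarith
    calc (T.card : ℝ) ≤ _ := h1
      _ ≤ 80 * (2 * n * (3 / 2 * √n)) := by gcongr
      _ = _ := by ring
  -- `ncard` is `0` on infinite sets, so finiteness needs its own proof; the uniform bound on finite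
  -- subsets provides it.
  have hfin : (pals G lab).Finite := by
    by_contra hinf
    obtain ⟨T, hT, hTc⟩ := Set.Infinite.exists_subset_card_eq hinf (⌊240 * (n * √(n : ℝ))⌋₊ + 1)
    have h1 := hbound T (fun W hW => hT hW)
    rw [hTc] at h1
    have := Nat.lt_floor_add_one (240 * (n * √(n : ℝ)))
    push_cast at h1
    linarith
  refine ⟨hfin, ?_⟩
  rw [Set.ncard_eq_toFinset_card _ hfin]
  exact hbound _ fun W hW => hfin.mem_toFinset.1 hW

end Upper

end LabelledTree

namespace LabelledTree

open SimpleGraph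

/-! ### The comb and the lower bound -/

section Lower

/-- The graph joining every vertex other than the root to its parent. -/
def parentGraph {V : Type v} (r : V) (par : V → V) : SimpleGraph V :=
  SimpleGraph.fromRel fun v w => v ≠ r ∧ par v = w

/-- Descending rank connects every vertex to the root and makes edges correspond bijectively to
non-root vertices; a connected graph with one edge fewer than vertices is a tree. -/
lemma parentGraph_isTree {V : Type v} [Finite V] {r : V} {par : V → V} (rk : V → ℕ)
    (hrk : ∀ v, v ≠ r → rk (par v) < rk v) :
    (parentGraph r par).IsTree ∧ (parentGraph r par).edgeSet.ncard + 1 = Nat.card V := by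
  have hadj : ∀ v, v ≠ r → (parentGraph r par).Adj v (par v) := by
    intro v hv
    refine (SimpleGraph.fromRel_adj _ _ _).2 ⟨fun h => ?_, Or.inl ⟨hv, rfl⟩⟩
    have := hrk v hv
    rw [← h] at this
    exact this.false
  have hconn : (parentGraph r par).Connected := by
    have hr : ∀ k v, rk v = k → (parentGraph r par).Reachable v r := by
      intro k
      induction k using Nat.strong_induction_on with
      | _ k ih =>
        intro v hv
        by_cases h : v = r
        · rw [h]
        · exact (hadj v h).reachable.trans (ih _ (hv ▸ hrk v h) _ rfl)
    have : Nonempty V := ⟨r⟩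
    exact ⟨fun v w => (hr _ v rfl).trans (hr _ w rfl).symm⟩
  have hedge : (parentGraph r par).edgeSet = (fun v => s(v, par v)) '' {r}ᶜ := by
    ext e
    induction e using Sym2.ind with
    | _ x y =>
      rw [mem_edgeSet]
      constructor
      · intro h
        obtain ⟨-, ⟨h1, h2⟩ | ⟨h1, h2⟩⟩ := (SimpleGraph.fromRel_adj _ _ _).1 h
        · exact ⟨x, h1, by simp [h2]⟩
        · exact ⟨y, h1, by simp [h2, Sym2.eq_swap]⟩
      · rintro ⟨v, hv, h⟩
        have := (mem_edgeSet _).2 (hadj v hv)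
        rwa [show s(v, par v) = s(x, y) from h] at this
  have hinj : Set.InjOn (fun v => s(v, par v)) ({r}ᶜ : Set V) := by
    intro v hv w hw h
    rcases Sym2.eq_iff.1 h with ⟨h1, -⟩ | ⟨h1, h2⟩
    · exact h1
    · have a := hrk v hv
      have b := hrk w hw
      rw [h2] at a
      rw [← h1] at b
      omega
  have hcard : (parentGraph r par).edgeSet.ncard + 1 = Nat.card V := by
    rw [hedge, hinj.ncard_image]
    have := Set.ncard_add_ncard_compl ({r} : Set V)
    rw [Set.ncard_singleton] at this
    omega
  exact ⟨isTree_iff_connected_and_card.2 ⟨hconn, by rwa [Nat.card_coe_set_eq]⟩, hcard⟩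

lemma exists_isPath_of_injOn {V : Type v} {G : SimpleGraph V} (γ : ℕ → V) (N : ℕ)
    (hadj : ∀ i < N, G.Adj (γ i) (γ (i + 1)))
    (hinj : ∀ i ≤ N, ∀ j ≤ N, γ i = γ j → i = j) :
    ∃ p : G.Walk (γ 0) (γ N), p.IsPath ∧
      p.edges = (List.range N).map fun i => s(γ i, γ (i + 1)) := by
  have hwalk : ∀ M ≤ N, ∃ p : G.Walk (γ 0) (γ M), p.support = (List.range (M + 1)).map γ ∧
      p.edges = (List.range M).map fun i => s(γ i, γ (i + 1)) := by
    intro M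
    induction M with
    | zero => exact fun _ => ⟨Walk.nil, by simp, by simp⟩
    | succ M ih =>
      intro hM
      obtain ⟨p, h1, h2⟩ := ih (by omega)
      refine ⟨p.concat (hadj M (by omega)), ?_, ?_⟩
      · rw [Walk.support_concat, h1, List.range_succ (n := M + 1)]
        simp
      · rw [Walk.edges_concat, h2, List.range_succ (n := M)]
        simp
  obtain ⟨p, h1, h2⟩ := hwalk N le_rfl
  refine ⟨p, ?_, h2⟩
  rw [Walk.isPath_def, h1]
  refine List.Nodup.map_on (fun i hi j hj h => ?_) List.nodup_range
  rw [List.mem_range] at hi hj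
  exact hinj i (by omega) j (by omega) h

/-- The word consisting of `k` letters `b`, then `d` letters `a`, then `k` letters `b`. -/
def blockWord {α : Type u} (a b : α) (k d : ℕ) : List α :=
  (List.range (2 * k + d)).map fun i => if i < k ∨ k + d ≤ i then b else a

lemma blockWord_reverse {α : Type u} (a b : α) (k d : ℕ) :
    blockWord a b k d = (blockWord a b k d).reverse := by
  apply List.ext_getElem (by simp)
  intro i h1 h2
  simp only [blockWord, List.length_map, List.length_range] at h1
  simp only [blockWord, List.getElem_reverse, List.getElem_map, List.getElem_range,
    List.length_map, List.length_range]
  split_ifs <;> first | rfl | omega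

/-- As `d` is positive, `k` is the position of the first `a`; the length then gives `d`. -/
lemma blockWord_injective {α : Type u} {a b : α} (hab : a ≠ b) {k d k' d' : ℕ} (hd : 1 ≤ d)
    (hd' : 1 ≤ d') (h : blockWord a b k d = blockWord a b k' d') : k = k' ∧ d = d' := by
  have hlen : 2 * k + d = 2 * k' + d' := by
    simpa [blockWord] using congrArg List.length h
  have key : ∀ {k d k' d' : ℕ}, 1 ≤ d → 2 * k + d = 2 * k' + d' →
      blockWord a b k d = blockWord a b k' d' → ¬ k < k' := by
    intro k d k' d' hd hlen h hlt
    have := congrArg (fun w => w[k]?) h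
    simp only [blockWord, List.getElem?_map] at this
    rw [List.getElem?_range (by omega), List.getElem?_range (by omega), Option.map_some,
      Option.map_some, if_neg (by omega), if_pos (by omega)] at this
    exact hab (Option.some.inj this)
  have h1 := key hd hlen h
  have h2 := key hd' hlen.symm h.symm
  omega

/-- The vertices of a comb: a spine with `s` edges and `2 * m` teeth with `m` vertices each. -/
abbrev CombVertex (s m : ℕ) : Type := Fin (s + 1) ⊕ (Fin (2 * m) × Fin m)

/-- The positions of the teeth on the spine: `0, …, m - 1` and `m, 2 * m, …, m * m`. -/
def toothPos (m t : ℕ) : ℕ := if t < m then t else (t - m + 1) * m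

lemma toothPos_le {m t : ℕ} (ht : t < 2 * m) : toothPos m t ≤ m * m := by
  unfold toothPos
  split_ifs with h
  · nlinarith
  · exact Nat.mul_le_mul_right m (by omega)

/-- The spine vertex at position `i`. -/
def spine (s m i : ℕ) : CombVertex s m := Sum.inl ⟨min i s, by omega⟩

/-- The vertex at height `h` on the tooth `t`. -/
def tooth {s m : ℕ} (t : Fin (2 * m)) (h : ℕ) : CombVertex s m :=
  Sum.inr (t, ⟨min h (m - 1), by have := t.2; omega⟩)

/-- The neighbour of a vertex of the comb towards the start of the spine. -/
def combParent (s m : ℕ) : CombVertex s m → CombVertex s m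
  | Sum.inl i => spine s m (i - 1)
  | Sum.inr (t, h) => if (h : ℕ) = 0 then spine s m (toothPos m t) else tooth t (h - 1)

/-- The comb graph. -/
def comb (s m : ℕ) : SimpleGraph (CombVertex s m) := parentGraph (spine s m 0) (combParent s m)

open Classical in
/-- The labelling of the comb: `a` on the spine and `b` on the teeth. -/
noncomputable def combLabel {α : Type u} (s m : ℕ) (a b : α) (e : Sym2 (CombVertex s m)) : α :=
  if ∃ x, Sum.inr x ∈ e then b else a

lemma comb_isTree (s m : ℕ) : (comb s m).IsTree ∧ (comb s m).edgeSet.ncard = s + 2 * m * m := by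
  have h := parentGraph_isTree (r := spine s m 0) (par := combParent s m)
    -- The rank is the position on the spine; teeth are ranked by height, above the whole spine.
    (Sum.elim (fun i : Fin (s + 1) => (i : ℕ)) fun x : Fin (2 * m) × Fin m => s + 1 + (x.2 : ℕ)) (by
      rintro (i | ⟨t, h⟩) hv
      · have : (i : ℕ) ≠ 0 := by
          intro h0
          apply hv
          simp only [spine, Sum.inl.injEq]
          ext
          simp [h0]
        simp only [combParent, spine, Sum.elim_inl]
        omega
      · simp only [combParent]
        split_ifs with h0
        · simp only [spine, Sum.elim_inl, Sum.elim_inr]; omega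
        · simp only [tooth, Sum.elim_inr]; omega)
  refine ⟨h.1, ?_⟩
  have h2 := h.2
  simp only [Nat.card_eq_fintype_card, Fintype.card_sum, Fintype.card_prod, Fintype.card_fin] at h2
  unfold comb
  omega

lemma spine_injective {s m i j : ℕ} (hi : i ≤ s) (hj : j ≤ s) (h : spine s m i = spine s m j) :
    i = j := by
  simp only [spine, Sum.inl.injEq, Fin.mk.injEq] at h
  omega

lemma tooth_injective {s m i j : ℕ} {t t' : Fin (2 * m)} (hi : i < m) (hj : j < m)
    (h : (tooth t i : CombVertex s m) = tooth t' j) : t = t' ∧ i = j := by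
  simp only [tooth, Sum.inr.injEq, Prod.mk.injEq, Fin.mk.injEq] at h
  exact ⟨h.1, by omega⟩

lemma spine_ne_tooth {s m i j : ℕ} {t : Fin (2 * m)} : spine s m i ≠ tooth t j := by
  simp [spine, tooth]

lemma comb_adj_spine {s m i : ℕ} (hi : i < s) :
    (comb s m).Adj (spine s m i) (spine s m (i + 1)) := by
  refine (SimpleGraph.fromRel_adj _ _ _).2 ⟨fun h => ?_, Or.inr ⟨fun h => ?_, ?_⟩⟩
  · have := spine_injective (by omega) (by omega) h; omega
  · have := spine_injective (by omega) (by omega) h; omega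
  · simp only [combParent, spine, Sum.inl.injEq, Fin.mk.injEq]; omega

lemma comb_adj_tooth {s m h : ℕ} {t : Fin (2 * m)} (hh : h + 1 < m) :
    (comb s m).Adj (tooth t h) (tooth t (h + 1)) := by
  refine (SimpleGraph.fromRel_adj _ _ _).2 ⟨fun e => ?_, Or.inr ⟨spine_ne_tooth.symm, ?_⟩⟩
  · have := (tooth_injective (by omega) (by omega) e).2; omega
  · simp only [combParent, tooth]
    rw [if_neg (by omega)]
    simp only [Sum.inr.injEq, Prod.mk.injEq, Fin.mk.injEq, true_and]
    omega

lemma comb_adj_attach {s m : ℕ} {t : Fin (2 * m)} :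
    (comb s m).Adj (spine s m (toothPos m t)) (tooth t 0) := by
  refine (SimpleGraph.fromRel_adj _ _ _).2
    ⟨spine_ne_tooth, Or.inr ⟨spine_ne_tooth.symm, ?_⟩⟩
  simp [combParent, tooth]

/-- The palindromes read between two teeth of the comb. -/
lemma blockWord_mem_pals {α : Type u} (a b : α) {s m k d : ℕ} (hk : k ≤ m) (hd : 1 ≤ d)
    (t t' : Fin (2 * m)) (hpos : toothPos m t + d = toothPos m t') (hs : m * m ≤ s) :
    blockWord a b k d ∈ pals (comb s m) (combLabel s m a b) := by
  refine ⟨?_, blockWord_reverse a b k d⟩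
  have hle := toothPos_le t'.2
  have hne : t ≠ t' := by rintro rfl; omega
  -- Down the tooth `t` from height `k - 1`, along `d` spine edges, up the tooth `t'`. The edge
  -- attaching a tooth also carries `b`, so `k` tooth vertices give `k` letters.
  set γ : ℕ → CombVertex s m := fun i =>
    if i < k then tooth t (k - 1 - i)
    else if i ≤ k + d then spine s m (toothPos m t + (i - k)) else tooth t' (i - k - d - 1) with hγ
  have g1 : ∀ i, i < k → γ i = tooth t (k - 1 - i) := fun i hi => if_pos hi
  have g2 : ∀ i, k ≤ i → i ≤ k + d → γ i = spine s m (toothPos m t + (i - k)) := by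
    intro i hi hi'
    simp only [hγ]
    rw [if_neg (by omega), if_pos hi']
  have g3 : ∀ i, k + d < i → γ i = tooth t' (i - k - d - 1) := by
    intro i hi
    simp only [hγ]
    rw [if_neg (by omega), if_neg (by omega)]
  have hadj : ∀ i < 2 * k + d, (comb s m).Adj (γ i) (γ (i + 1)) := by
    intro i hi
    rcases lt_trichotomy (i + 1) k with h | h | h
    · rw [g1 i (by omega), g1 (i + 1) h, show k - 1 - i = (k - 1 - (i + 1)) + 1 by omega]
      exact (comb_adj_tooth (by omega)).symm
    · rw [g1 i (by omega), g2 (i + 1) (by omega) (by omega), show k - 1 - i = 0 by omega,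
        show i + 1 - k = 0 by omega, add_zero]
      exact comb_adj_attach.symm
    · rcases lt_trichotomy i (k + d) with h' | h' | h'
      · rw [g2 i (by omega) (by omega), g2 (i + 1) (by omega) (by omega),
          show toothPos m t + (i + 1 - k) = toothPos m t + (i - k) + 1 by omega]
        exact comb_adj_spine (by omega)
      · rw [g2 i (by omega) (by omega), g3 (i + 1) (by omega), show i + 1 - k - d - 1 = 0 by omega,
          show toothPos m t + (i - k) = toothPos m t' by omega]
        exact comb_adj_attach
      · rw [g3 i h', g3 (i + 1) (by omega),
          show i + 1 - k - d - 1 = (i - k - d - 1) + 1 by omega]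
        exact comb_adj_tooth (by omega)
  have hinj : ∀ i ≤ 2 * k + d, ∀ j ≤ 2 * k + d, γ i = γ j → i = j := by
    intro i hi j hj h
    wlog hij : i ≤ j generalizing i j
    · exact (this j hj i hi h.symm (by omega)).symm
    rcases Nat.lt_or_ge i k with hi1 | hi1
    · rw [g1 i hi1] at h
      rcases Nat.lt_or_ge j k with hj1 | hj1
      · rw [g1 j hj1] at h
        have := (tooth_injective (by omega) (by omega) h).2
        omega
      · rcases Nat.lt_or_ge (k + d) j with hj2 | hj2
        · rw [g3 j hj2] at h
          exact absurd (tooth_injective (by omega) (by omega) h).1 hne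
        · rw [g2 j hj1 hj2] at h
          exact absurd h.symm spine_ne_tooth
    · rcases Nat.lt_or_ge (k + d) i with hi2 | hi2
      · rw [g3 i hi2, g3 j (by omega)] at h
        have := (tooth_injective (by omega) (by omega) h).2
        omega
      · rw [g2 i hi1 hi2] at h
        rcases Nat.lt_or_ge (k + d) j with hj2 | hj2
        · rw [g3 j hj2] at h
          exact absurd h spine_ne_tooth
        · rw [g2 j (by omega) hj2] at h
          have := spine_injective (by omega) (by omega) h
          omega
  obtain ⟨p, hp, hedges⟩ := exists_isPath_of_injOn γ (2 * k + d) hadj hinj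
  refine ⟨_, _, p, hp, ?_⟩
  rw [label, hedges, List.map_map, blockWord]
  apply List.map_congr_left
  intro i hi
  rw [List.mem_range] at hi
  simp only [Function.comp, combLabel]
  split_ifs with h1 h2 h2
  · rfl
  · obtain ⟨x, hx⟩ := h1
    rw [g2 i (by omega) (by omega), g2 (i + 1) (by omega) (by omega), Sym2.mem_iff] at hx
    simp [spine] at hx
  · exfalso
    apply h1
    rcases h2 with h2 | h2
    · rw [g1 i h2]
      exact ⟨_, Sym2.mem_mk_left _ _⟩
    · rw [g3 (i + 1) (by omega)]
      exact ⟨_, Sym2.mem_mk_right _ _⟩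
  · rfl

/-- The distance `(q + 1) * m - t` between the teeth `t` and `m + q`, with `q, t < m`, takes each
value from `1` to `m * m` exactly once; `k` independently takes `m` values. -/
lemma pow_three_le_ncard_pals_comb {α : Type u} {a b : α} (hab : a ≠ b) {s m : ℕ}
    (hs : m * m ≤ s) (hfin : (pals (comb s m) (combLabel s m a b)).Finite) :
    m ^ 3 ≤ (pals (comb s m) (combLabel s m a b)).ncard := by
  set f : Fin m × Fin m × Fin m → List α := fun x =>
    blockWord a b (x.1 + 1) ((x.2.1 + 1) * m - x.2.2) with hf
  have hpos : ∀ q t : Fin m, 1 ≤ ((q : ℕ) + 1) * m - t := by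
    intro q t
    have := t.2
    have : m ≤ ((q : ℕ) + 1) * m := Nat.le_mul_of_pos_left m (by omega)
    omega
  have hlt : ∀ q t q' t' : Fin m, ((q : ℕ) + 1) * m - t = ((q' : ℕ) + 1) * m - t' → ¬ q < q' := by
    intro q t q' t' h hq
    have h1 : (q : ℕ) + 1 + 1 ≤ (q' : ℕ) + 1 := by have : (q : ℕ) < q' := hq; omega
    have h2 := Nat.mul_le_mul_right m h1
    rw [Nat.add_mul (_ + 1), one_mul] at h2
    have := t'.2
    have := hpos q' t'
    omega
  have hinj : Function.Injective f := by
    rintro ⟨k, q, t⟩ ⟨k', q', t'⟩ h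
    obtain ⟨h1, h2⟩ := blockWord_injective hab (hpos q t) (hpos q' t') h
    have hk : k = k' := Fin.ext (by simpa using h1)
    have hq : q = q' := le_antisymm (not_lt.1 (hlt _ _ _ _ h2.symm)) (not_lt.1 (hlt _ _ _ _ h2))
    subst hk hq
    have ht : t = t' := by
      apply Fin.ext
      have := hpos q t
      have := hpos q t'
      omega
    rw [ht]
  have hsub : Set.range f ⊆ pals (comb s m) (combLabel s m a b) := by
    rintro _ ⟨⟨k, q, t⟩, rfl⟩
    refine blockWord_mem_pals a b (by omega) (hpos q t) ⟨t, by omega⟩ ⟨m + q, by omega⟩ ?_ hs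
    have := hpos q t
    simp only [toothPos]
    rw [if_pos t.2, if_neg (by omega), Nat.add_sub_cancel_left]
    omega
  have h := Set.ncard_le_ncard hsub hfin
  rw [← Set.image_univ, Set.ncard_image_of_injective _ hinj, Set.ncard_univ] at h
  simp only [Nat.card_eq_fintype_card, Fintype.card_prod, Fintype.card_fin] at h
  calc m ^ 3 = m * (m * m) := by ring
    _ ≤ _ := h

lemma ncard_pals_pos {V : Type v} {α : Type u} {G : SimpleGraph V} (lab : Sym2 V → α)
    [Nonempty V] (hfin : (pals G lab).Finite) : 1 ≤ (pals G lab).ncard := by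
  obtain ⟨x⟩ := ‹Nonempty V›
  refine (Set.ncard_pos hfin).2 ⟨[], ⟨x, x, Walk.nil, Walk.IsPath.nil, rfl⟩, rfl⟩

/-- Some tree with `n` edges has `Ω(n ^ (3 / 2))` palindromic substrings. -/
theorem exists_mem_palCounts_ge (α : Type u) [Nontrivial α] {n : ℕ} (hn : 1 ≤ n) :
    ∃ c ∈ palCounts α n, 1 / 100 * (n * √(n : ℝ)) ≤ (c : ℝ) := by
  obtain ⟨a, b, hab⟩ := exists_pair_ne α
  -- The teeth use `2 * m * m` edges and the spine needs at least `m * m`; all remaining edges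
  -- lengthen the spine.
  set m := Nat.sqrt (n / 3) with hm
  have h1 : m * m ≤ n / 3 := Nat.sqrt_le _
  have h2 : n / 3 < (m + 1) * (m + 1) := Nat.lt_succ_sqrt _
  set s := n - 2 * m * m with hs
  have h2m : 2 * m * m = 2 * (m * m) := by ring
  obtain ⟨htree, hcard⟩ := comb_isTree s m
  have hcard' : (comb s m).edgeSet.ncard = n := by omega
  have hfin := (pals_finite_and_ncard_le htree (combLabel s m a b) hcard' hn).1
  refine ⟨_, ⟨CombVertex s m, inferInstance, comb s m, combLabel s m a b, htree, hcard', rfl⟩, ?_⟩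
  have h3 := pow_three_le_ncard_pals_comb hab (by omega) hfin
  have : Nonempty (CombVertex s m) := ⟨spine s m 0⟩
  have h4 := ncard_pals_pos (combLabel s m a b) hfin
  -- For `m = 0`, that is `n < 3`, the empty palindrome suffices. The constants multiply to `6 * 8 =
  -- 48 ≤ 100`.
  have h5 : (m + 1) ^ 3 ≤ 8 * (pals (comb s m) (combLabel s m a b)).ncard := by
    rcases Nat.eq_zero_or_pos m with h0 | h0
    · rw [h0] at h4 ⊢; omega
    · calc (m + 1) ^ 3 ≤ (2 * m) ^ 3 := Nat.pow_le_pow_left (by omega) 3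
        _ = 8 * m ^ 3 := by ring
        _ ≤ _ := by omega
  have h6 : (n : ℝ) ≤ 3 * (m + 1) ^ 2 := by
    have : n ≤ 3 * ((m + 1) * (m + 1)) := by omega
    have h : (n : ℝ) ≤ 3 * ((m + 1) * (m + 1)) := by exact_mod_cast this
    linarith
  have h7 : √(n : ℝ) ≤ 2 * (m + 1) := by
    apply Real.sqrt_le_iff.2 ⟨by positivity, ?_⟩
    nlinarith
  have h8 : ((m : ℝ) + 1) ^ 3 ≤ 8 * (pals (comb s m) (combLabel s m a b)).ncard := by
    exact_mod_cast h5
  have h9 : n * √(n : ℝ) ≤ 3 * (m + 1) ^ 2 * (2 * (m + 1)) := by gcongr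
  have h10 : 3 * ((m : ℝ) + 1) ^ 2 * (2 * (m + 1)) = 6 * (m + 1) ^ 3 := by ring
  linarith

end Lower

end LabelledTree

theorem theorem1 :
    ∃ c C : ℝ, 0 < c ∧ 0 < C ∧
      (∀ (α : Type u) (V : Type v) [Finite V] (G : SimpleGraph V) (lab : Sym2 V → α) (n : ℕ),
        G.IsTree → G.edgeSet.ncard = n → 1 ≤ n →
          (LabelledTree.pals G lab).Finite ∧
          ((LabelledTree.pals G lab).ncard : ℝ) ≤ C * (n : ℝ) ^ (3 / 2 : ℝ)) ∧
      (∀ (α : Type u) [Nontrivial α] (n : ℕ), 1 ≤ n →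
        IsGreatest (LabelledTree.palCounts α n) (LabelledTree.PAL α n) ∧
        c * (n : ℝ) ^ (3 / 2 : ℝ) ≤ (LabelledTree.PAL α n : ℝ) ∧
        (LabelledTree.PAL α n : ℝ) ≤ C * (n : ℝ) ^ (3 / 2 : ℝ)) := by
  have hpow : ∀ n : ℕ, 1 ≤ n → (n : ℝ) ^ (3 / 2 : ℝ) = n * √(n : ℝ) := by
    intro n hn
    have hn0 : (0 : ℝ) < n := by exact_mod_cast hn
    rw [Real.sqrt_eq_rpow, show (3 / 2 : ℝ) = 1 + 1 / 2 by norm_num, Real.rpow_add hn0,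
      Real.rpow_one]
  refine ⟨1 / 100, 240, by norm_num, by norm_num, ?_, ?_⟩
  · intro α V _ G lab n hG hn hn1
    rw [hpow n hn1]
    exact LabelledTree.pals_finite_and_ncard_le hG lab hn hn1
  · intro α _ n hn
    rw [hpow n hn]
    have hub : ∀ c ∈ LabelledTree.palCounts α n, (c : ℝ) ≤ 240 * (n * √(n : ℝ)) := by
      rintro _ ⟨V, _, G, lab, hG, hE, rfl⟩
      exact (LabelledTree.pals_finite_and_ncard_le hG lab hE hn).2
    have hbdd : BddAbove (LabelledTree.palCounts α n) :=
      ⟨⌊240 * (n * √(n : ℝ))⌋₊, fun c hc => Nat.le_floor (hub c hc)⟩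
    obtain ⟨c, hc, hcn⟩ := LabelledTree.exists_mem_palCounts_ge α hn
    -- A nonempty bounded set of naturals attains its supremum; nonemptiness comes from the comb.
    have hmem : LabelledTree.PAL α n ∈ LabelledTree.palCounts α n := Nat.sSup_mem ⟨c, hc⟩ hbdd
    have hle : ∀ k ∈ LabelledTree.palCounts α n, k ≤ LabelledTree.PAL α n :=
      fun k hk => le_csSup hbdd hk
    refine ⟨⟨hmem, hle⟩, hcn.trans ?_, hub _ hmem⟩
    exact_mod_cast hle c hc
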